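/- An involution of length $n$ is a permutation $\pi$ of $\{1,\dots,n\}$ with $\pi(\pi(i))=i$ for all $i$; write $|\pi|=n$ for its length. A subsequence of $\pi$ has type $\sigma$ if its entries have the same pairwise comparisons as those of $\sigma$, and $\pi$ avoids $\sigma$ if no subsequence of $\pi$ has type $\sigma$. Let $U_n$ denote the $n$th Chebyshev polynomial of the second kind, $U_n(\cos t)=\sin((n+1)t)/\sin t$. Theorem. Fix integers $r\ge 1$, $k\ge 1$ and $b\ge 0$ such that $$r<\min\left(\binom{2k+2b+2}{2k-1},\ \binom{2k+2b}{2k-1}+\binom{2k+2b+1}{2k-1}\right).$$ Then, as formal Laurent series in $x$ over $\mathbb{Q}$, $$\sum_{\pi}x^{|\pi|}=\sum_{(d,l)}\left(\prod_{i=0}^{b}\binom{d_i+d_{i+1}+l_i-1}{d_{i+1}+l_i}\binom{d_{i+1}+l_i}{l_i}\right)\frac{\left(U_{k-1}\left(\frac{1-x}{2x}\right)\right)^{d_0-1}}{\left(U_{k}\left(\frac{1-x}{2x}\right)\right)^{d_0+1}}\;x^{-1-d_0+\sum_{j=0}^{b}(2d_j+l_j)}.$$ The sum on the left is over all involutions $\pi$,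 of any length, which avoid $3412$ and contain exactly $r$ subsequences of type $2k\,(2k-1)\cdots 2\,1$. The sum on the right is over the (finitely many) pairs of sequences $d_0,\dots,d_b$ and $l_0,\dots,l_b$ of nonnegative integers such that $$r=\sum_{i=0}^{b}d_i\left(\binom{2k+2i-2}{2k-1}+\binom{2k+2i-1}{2k-1}\right)+\sum_{i=0}^{b}l_i\binom{2k+2i}{2k-1}.$$ Here $d_{b+1}=0$, $\binom{a}{0}=1$ for every integer $a$, and $\binom{a}{m}=0$ for integers $0\le a<m$. -/

import Mathlib

/-- The permutation `3412`, written on the letters `0, 1, 2, 3`. -/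
def pattern3412 : Equiv.Perm (Fin 4) where
  toFun := ![2, 3, 0, 1]
  invFun := ![2, 3, 0, 1]
  left_inv := by decide
  right_inv := by decide

/-- The decreasing permutation `m … 2 1`, written on the letters `0, …, m - 1`. -/
def decreasingPattern (m : ℕ) : Equiv.Perm (Fin m) := Fin.revPerm

/-- The subsequences of `π` of type `σ`. A subsequence is given by its positions, that is, by a
strictly increasing map from `Fin m` to `Fin n`; it has type `σ` when its entries have the same
pairwise comparisons as the entries of `σ`. -/
def subsequencesOfType {m n : ℕ} (σ : Equiv.Perm (Fin m)) (π : Equiv.Perm (Fin n)) :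
    Set (Fin m ↪o Fin n) :=
  {f | ∀ i j : Fin m, π (f i) < π (f j) ↔ σ i < σ j}

/-- `π` avoids `σ`. -/
def Avoids {m n : ℕ} (π : Equiv.Perm (Fin n)) (σ : Equiv.Perm (Fin m)) : Prop :=
  subsequencesOfType σ π = ∅

/-- The involutions of length `n` (those `π` with `π (π i) = i` for all `i`) which avoid `3412` and
contain exactly `r` subsequences of type `m … 2 1`. -/
def involutionsWith (m r n : ℕ) : Set (Equiv.Perm (Fin n)) :=
  {π | Function.Involutive π ∧ Avoids π pattern3412 ∧
    (subsequencesOfType (decreasingPattern m) π).ncard = r}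

/-- The generating function `∑_π x ^ |π|` over all involutions `π`, of any length, which avoid
`3412` and contain exactly `r` subsequences of type `m … 2 1`. -/
noncomputable def involutionGF (m r : ℕ) : PowerSeries ℚ :=
  PowerSeries.mk fun n => ((involutionsWith m r n).ncard : ℚ)

/-- The pairs of sequences `d_0, …, d_b` and `l_0, …, l_b` of nonnegative integers with
`r = ∑ d_i (C(2k+2i-2, 2k-1) + C(2k+2i-1, 2k-1)) + ∑ l_i C(2k+2i, 2k-1)`. -/
def indexSet (k b r : ℕ) : Set ((Fin (b + 1) → ℕ) × (Fin (b + 1) → ℕ)) :=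
  {p | r = ∑ i : Fin (b + 1), p.1 i * ((2 * k + 2 * (i : ℕ) - 2).choose (2 * k - 1) +
              (2 * k + 2 * (i : ℕ) - 1).choose (2 * k - 1)) +
           ∑ i : Fin (b + 1), p.2 i * (2 * k + 2 * (i : ℕ)).choose (2 * k - 1)}

/-- There are only finitely many such pairs, so the sum over them is a finite sum. -/
theorem indexSet_finite {k : ℕ} (hk : 1 ≤ k) (b r : ℕ) : (indexSet k b r).Finite := by
  apply Set.Finite.subset
    ((Set.finite_Iic (fun _ => r : Fin (b + 1) → ℕ)).prod
      (Set.finite_Iic (fun _ => r : Fin (b + 1) → ℕ)))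
  rintro ⟨d, l⟩ h
  simp only [indexSet, Set.mem_ofPred_eq] at h
  refine ⟨fun i => ?_, fun i => ?_⟩
  · have h1 := Finset.single_le_sum (f := fun i : Fin (b + 1) =>
      d i * ((2 * k + 2 * (i : ℕ) - 2).choose (2 * k - 1) +
        (2 * k + 2 * (i : ℕ) - 1).choose (2 * k - 1)))
      (fun _ _ => Nat.zero_le _) (Finset.mem_univ i)
    have h2 : 0 < (2 * k + 2 * (i : ℕ) - 1).choose (2 * k - 1) := Nat.choose_pos (by omega)
    have h3 : d i ≤ d i * ((2 * k + 2 * (i : ℕ) - 2).choose (2 * k - 1) +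
        (2 * k + 2 * (i : ℕ) - 1).choose (2 * k - 1)) := Nat.le_mul_of_pos_right _ (by omega)
    simp only at h1 ⊢
    omega
  · have h1 := Finset.single_le_sum (f := fun i : Fin (b + 1) =>
      l i * (2 * k + 2 * (i : ℕ)).choose (2 * k - 1))
      (fun _ _ => Nat.zero_le _) (Finset.mem_univ i)
    have h2 : 0 < (2 * k + 2 * (i : ℕ)).choose (2 * k - 1) := Nat.choose_pos (by omega)
    have h3 : l i ≤ l i * (2 * k + 2 * (i : ℕ)).choose (2 * k - 1) :=
      Nat.le_mul_of_pos_right _ h2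
    simp only at h1 ⊢
    omega

/-- The entry `d_{i+1}` of a sequence `d_0, …, d_b`, where `d_{b+1} = 0`. -/
def nextEntry {b : ℕ} (d : Fin (b + 1) → ℕ) (i : Fin (b + 1)) : ℕ :=
  if h : (i : ℕ) + 1 < b + 1 then d ⟨(i : ℕ) + 1, h⟩ else 0

/-- The coefficient `∏_{i=0}^b C(d_i + d_{i+1} + l_i - 1, d_{i+1} + l_i) C(d_{i+1} + l_i, l_i)`.
The upper entry `d_i + d_{i+1} + l_i - 1` is `-1` only if `d_i = d_{i+1} = l_i = 0`; the truncated
subtraction then makes the first factor `C(0, 0) = 1`, in accordance with `C(-1, 0) = 1`. -/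
def binomialWeight {b : ℕ} (d l : Fin (b + 1) → ℕ) : ℕ :=
  ∏ i : Fin (b + 1), (d i + nextEntry d i + l i - 1).choose (nextEntry d i + l i) *
    (nextEntry d i + l i).choose (l i)

/-- The indeterminate `x`, in the field of formal Laurent series over `ℚ`. -/
noncomputable def xL : LaurentSeries ℚ := HahnSeries.single 1 1

/-- `U_n((1 - x) / (2 x))`, with `U_n` the Chebyshev polynomial of the second kind. -/
noncomputable def chebyshevAt (n : ℤ) : LaurentSeries ℚ :=
  (Polynomial.Chebyshev.U (LaurentSeries ℚ) n).eval ((1 - xL) / (2 * xL))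

/-!
An involution avoids `3412` exactly when its 2-cycles, drawn as arcs, do not cross
(`avoids_pattern3412_iff`). Reading fixed points as level steps and the ends of the arcs as up and
down steps, one obtains a bijection with Motzkin paths (`MotzkinTree.exists_toFun_eq`,
`MotzkinTree.toFun_injective`).

Let `F` be the generating polynomial, in `q`, of the decreasing subsequences of such an involution.
Then `F - 1` is additive under juxtaposition, and putting an arc around an involution multiplies `F`
by `(1 + q) ^ 2`. So a fixed point inside `h` arcs contributes `C(2h, m - 1)` to the number of
decreasing subsequences of length `m`, and an arc inside `h` others contributes
`C(2h, m - 1) + C(2h + 1, m - 1)` (`MotzkinTree.coeff_decreasingPoly_toFun`).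

Hence, if `x` marks the length and `q` the number of subsequences `2k … 2 1`, the generating
functions `Z h` of the paths from height `h` satisfy
`Z h = 1 / (1 - A h - B h * Z (h + 1))`, where `A h` and `B h` are `x` and `x ^ 2` times the powers
of `q` with these exponents. Modulo `q ^ (r + 1)` the fraction is finite. Its first `k` levels have
`A h = x`, and `B h = x ^ 2` except for the last one, so that with `y = B (k - 1) * Z k`
they give a linear fractional function of `y` whose coefficients are essentially Chebyshev
polynomials at `(1 - x) / (2 x)`; its determinant is a power of `x` (`heightPoly_sq_sub`). Its
expansion in powers of `y` produces the Chebyshev quotients, and expanding the powers of `Z k`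
level by level produces the binomial coefficients (`continuedFraction_eq_sum`). The theorem is the
coefficient of `q ^ r`. The terms with `d 0 = 0` vanish because `r ≥ 1`
(`binomialWeight_eq_zero`).
-/

/-! ### Motzkin trees -/

/-- A Motzkin path, parsed by its first return to the starting height: it is empty (`nil`), or a
level step followed by a path (`level t`), or an up step, a path `s` one unit higher, the matching
down step and a path `t` (`arc s t`). -/
inductive MotzkinTree : Type
  | nil : MotzkinTree
  | level (t : MotzkinTree) : MotzkinTree
  | arc (s t : MotzkinTree) : MotzkinTree

namespace MotzkinTree

/-- The number of steps of the path. -/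
def size : MotzkinTree → ℕ
  | nil => 0
  | level t => t.size + 1
  | arc s t => s.size + t.size + 2

open Classical in
/-- The finite set of paths with `n` steps. -/
noncomputable def ofSize : ℕ → Finset MotzkinTree
  | 0 => {nil}
  | 1 => {level nil}
  | n + 2 => (ofSize (n + 1)).image level ∪
      (Finset.HasAntidiagonal.antidiagonal n).attach.biUnion fun p =>
        (ofSize p.1.1 ×ˢ ofSize p.1.2).image fun q => arc q.1 q.2
  decreasing_by
    · omega
    · have := Finset.HasAntidiagonal.mem_antidiagonal.1 p.2
      omega
    · have := Finset.HasAntidiagonal.mem_antidiagonal.1 p.2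
      omega

theorem mem_ofSize {n : ℕ} {t : MotzkinTree} : t ∈ ofSize n ↔ t.size = n := by
  induction n using Nat.strong_induction_on generalizing t with
  | _ n ih =>
    match n with
    | 0 => cases t <;> simp [ofSize, size]
    | 1 =>
      cases t with
      | nil => simp [ofSize, size]
      | level t => cases t <;> simp [ofSize, size]
      | arc s t => simp [ofSize, size]
    | n + 2 =>
      simp only [ofSize, Finset.mem_union, Finset.mem_image, Finset.mem_biUnion, Finset.mem_attach,
        true_and, Subtype.exists, Finset.HasAntidiagonal.mem_antidiagonal, Prod.exists,
        Finset.mem_product]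
      cases t with
      | nil => simp [size]
      | level t =>
        have := ih (n + 1) (by omega) (t := t)
        simp [size, this]
      | arc s t =>
        simp only [size, reduceCtorEq, and_false, exists_false, false_or, arc.injEq]
        constructor
        · rintro ⟨i, j, h, s', t', ⟨hs, ht⟩, rfl, rfl⟩
          rw [ih i (by omega)] at hs
          rw [ih j (by omega)] at ht
          omega
        · intro h
          refine ⟨s.size, t.size, by omega, s, t, ⟨?_, ?_⟩, rfl, rfl⟩
          · rw [ih _ (by omega)]
          · rw [ih _ (by omega)]

/-- The weight of a path that starts at height `h`: the product of a factor `a i` for each level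
step at height `i` and a factor `b i` for each up step from height `i`. -/
def weight {S : Type*} [CommSemiring S] (a b : ℕ → S) : ℕ → MotzkinTree → S
  | _, nil => 1
  | h, level t => a h * weight a b h t
  | h, arc s t => b h * weight a b (h + 1) s * weight a b h t

/-- The generating function of the weighted paths from height `h`, by number of steps. -/
noncomputable def weightGF {S : Type*} [CommSemiring S] (a b : ℕ → S) (h : ℕ) : PowerSeries S :=
  PowerSeries.mk fun n => ∑ t ∈ ofSize n, weight a b h t

/-- The recursion behind the continued fraction expansion of the generating function. -/
theorem weightGF_eq {S : Type*} [CommSemiring S] (a b : ℕ → S) (h : ℕ) :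
    weightGF a b h = 1 + PowerSeries.C (a h) * PowerSeries.X * weightGF a b h +
      PowerSeries.C (b h) * PowerSeries.X ^ 2 * weightGF a b (h + 1) * weightGF a b h := by
  classical
  ext n
  have e1 : PowerSeries.C (a h) * PowerSeries.X * weightGF a b h =
      PowerSeries.C (a h) * (weightGF a b h * PowerSeries.X) := by ring
  have e2 : PowerSeries.C (b h) * PowerSeries.X ^ 2 * weightGF a b (h + 1) * weightGF a b h =
      PowerSeries.C (b h) * ((weightGF a b (h + 1) * weightGF a b h) * PowerSeries.X ^ 2) := by
    ring
  rw [e1, e2, map_add, map_add, PowerSeries.coeff_C_mul, PowerSeries.coeff_C_mul]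
  match n with
  | 0 => simp [weightGF, ofSize, weight]
  | 1 =>
    rw [PowerSeries.coeff_succ_mul_X, PowerSeries.coeff_mul_X_pow']
    simp [weightGF, ofSize, weight, PowerSeries.coeff_one]
  | n + 2 =>
    rw [PowerSeries.coeff_succ_mul_X, PowerSeries.coeff_mul_X_pow, PowerSeries.coeff_mul]
    simp only [weightGF, PowerSeries.coeff_mk, PowerSeries.coeff_one, Nat.add_eq_zero_iff,
      OfNat.ofNat_ne_zero, and_false, if_false, zero_add]
    rw [ofSize, Finset.sum_union, Finset.sum_image, Finset.sum_biUnion]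
    · congr 1
      · simp only [weight, Finset.mul_sum]
      · rw [Finset.mul_sum, ← Finset.sum_attach (Finset.HasAntidiagonal.antidiagonal n)]
        refine Finset.sum_congr rfl fun p _ => ?_
        rw [Finset.sum_image, Finset.sum_mul_sum, Finset.mul_sum, Finset.sum_product]
        · refine Finset.sum_congr rfl fun s _ => ?_
          rw [Finset.mul_sum]
          refine Finset.sum_congr rfl fun t _ => ?_
          rw [weight, mul_assoc]
        · rintro ⟨s, t⟩ _ ⟨s', t'⟩ _ h
          simpa using h
    · intro p _ p' _ hne
      rw [Function.onFun, Finset.disjoint_left]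
      intro u hu hu'
      simp only [Finset.mem_image, Finset.mem_product, Prod.exists, mem_ofSize] at hu hu'
      obtain ⟨s, t, ⟨h1, h2⟩, rfl⟩ := hu
      obtain ⟨s', t', ⟨h3, h4⟩, h5⟩ := hu'
      obtain ⟨rfl, rfl⟩ := arc.inj h5
      exact hne (Subtype.ext (Prod.ext (h1.symm.trans h3) (h2.symm.trans h4)))
    · intro t _ t' _ h
      exact level.inj h
    · rw [Finset.disjoint_left]
      intro u hu hu'
      simp only [Finset.mem_image, Finset.mem_biUnion, Finset.mem_product, Prod.exists] at hu hu'
      obtain ⟨t, _, rfl⟩ := hu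
      obtain ⟨_, _, _, _, _, h⟩ := hu'
      cases h

end MotzkinTree

/-! ### Noncrossing involutions -/

/-- An involution of `ℕ` that moves only points of the interval `[a, a + n)` and whose 2-cycles,
drawn as arcs, do not cross. -/
structure IsNoncrossing (a n : ℕ) (f : ℕ → ℕ) : Prop where
  involutive : ∀ x, f (f x) = x
  eq_self : ∀ x, x < a ∨ a + n ≤ x → f x = x
  noncrossing : ∀ x y, ¬(x < y ∧ y < f x ∧ f x < f y)

namespace IsNoncrossing

variable {a n : ℕ} {f : ℕ → ℕ}

theorem mapsTo (hf : IsNoncrossing a n f) {x : ℕ} (h1 : a ≤ x) (h2 : x < a + n) :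
    a ≤ f x ∧ f x < a + n := by
  have h := hf.involutive x
  have h3 := hf.eq_self (f x)
  by_contra hc
  have h4 := h3 (by omega)
  omega

theorem eq_id_of_zero (hf : IsNoncrossing a 0 f) : f = id :=
  funext fun x => hf.eq_self x (by omega)

/-- If the left end of the interval is fixed, it can be removed. -/
theorem tail (hf : IsNoncrossing a (n + 1) f) (ha : f a = a) : IsNoncrossing (a + 1) n f where
  involutive := hf.involutive
  eq_self x hx := by
    rcases Nat.lt_trichotomy x a with h | rfl | h
    · exact hf.eq_self x (by omega)
    · exact ha
    · exact hf.eq_self x (by omega)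
  noncrossing := hf.noncrossing

/-- No arc leaves the interval spanned by the arc at the left end. -/
theorem lt_apply_left (hf : IsNoncrossing a n f) {x : ℕ} (h1 : a < x) (h2 : x < f a) :
    a < f x ∧ f x < f a := by
  have e1 := hf.involutive x
  have e2 := hf.involutive a
  have h3 := hf.noncrossing a x
  have h4 : f x ≠ f a := fun h => by rw [h, e2] at e1; omega
  have h5 : f x ≠ a := fun h => by rw [h] at e1; omega
  have h6 : a < a + n := by
    by_contra hc
    have := hf.eq_self a (by omega)
    omega
  have h7 := (hf.mapsTo le_rfl h6).2
  have h8 := (hf.mapsTo h1.le (by omega)).1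
  omega

theorem apply_left_lt (hf : IsNoncrossing a n f) (ha : a < f a) {x : ℕ} (h : f a < x) :
    f a < f x := by
  have e1 := hf.involutive x
  have e2 := hf.involutive a
  by_contra hc
  rcases Nat.lt_trichotomy a (f x) with h1 | h1 | h1
  · rcases Nat.lt_or_ge (f x) (f a) with h2 | h2
    · have := hf.lt_apply_left h1 h2
      omega
    · have : f x = f a := by omega
      rw [this] at e1
      omega
  · rw [← h1] at e1
    omega
  · have := hf.eq_self (f x) (by omega)
    omega

/-- The part of the involution under the arc at the left end. -/
theorem inner (hf : IsNoncrossing a n f) :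
    IsNoncrossing (a + 1) (f a - a - 1) fun x => if a < x ∧ x < f a then f x else x where
  involutive x := by
    have e1 := hf.involutive x
    by_cases h : a < x ∧ x < f a
    · simp only [h, and_self, if_true, hf.lt_apply_left h.1 h.2, e1]
    · simp only [h, if_false]
  eq_self x hx := if_neg (by omega)
  noncrossing x y := by
    have h := hf.noncrossing x y
    split_ifs <;> omega

/-- The part of the involution to the right of the arc at the left end. -/
theorem outer (hf : IsNoncrossing a n f) (ha : a < f a) :
    IsNoncrossing (f a + 1) (a + n - f a - 1) fun x => if f a < x then f x else x where
  involutive x := by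
    have e1 := hf.involutive x
    by_cases h : f a < x
    · simp only [h, if_true, hf.apply_left_lt ha h, e1]
    · simp only [h, if_false]
  eq_self x hx := by
    have := hf.eq_self x
    split_ifs <;> omega
  noncrossing x y := by
    have h := hf.noncrossing x y
    split_ifs <;> omega

end IsNoncrossing

namespace MotzkinTree

/-- The involution encoded by a path whose steps are numbered from `a` on: level steps are fixed
points, and matching up and down steps are exchanged. -/
def toFun : ℕ → MotzkinTree → ℕ → ℕ
  | _, nil, x => x
  | a, level t, x => toFun (a + 1) t x
  | a, arc s t, x =>
    if x = a then a + 1 + s.size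
    else if x = a + 1 + s.size then a
    else if x < a + 1 + s.size then toFun (a + 1) s x
    else toFun (a + 2 + s.size) t x

theorem isNoncrossing_toFun (a : ℕ) (t : MotzkinTree) : IsNoncrossing a t.size (toFun a t) := by
  induction t generalizing a with
  | nil => exact ⟨fun _ => rfl, fun _ _ => rfl, fun x y => by simp only [toFun]; omega⟩
  | level t ih =>
    refine ⟨(ih _).involutive, fun x hx => (ih _).eq_self x ?_, (ih _).noncrossing⟩
    simp only [size] at hx
    omega
  | arc s t ihs iht =>
    specialize ihs (a + 1)
    specialize iht (a + 2 + s.size)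
    have hs : ∀ x, a < x → x < a + 1 + s.size →
        a < toFun (a + 1) s x ∧ toFun (a + 1) s x < a + 1 + s.size := fun x h1 h2 => by
      have := ihs.mapsTo (x := x) (by omega) (by omega)
      omega
    have ht : ∀ x, a + 1 + s.size < x → a + 1 + s.size < toFun (a + 2 + s.size) t x :=
      fun x h1 => by
        by_cases h : x < a + 2 + s.size + t.size
        · have := iht.mapsTo (x := x) (by omega) h
          omega
        · rw [iht.eq_self x (by omega)]
          exact h1
    have hs' : ∀ x, x < a → toFun (a + 1) s x = x := fun x h => ihs.eq_self x (by omega)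
    refine ⟨fun x => ?_, fun x hx => ?_, fun x y => ?_⟩
    · have e1 := ihs.involutive x
      have e2 := iht.involutive x
      have := hs x
      have := ht x
      have := hs' x
      simp only [toFun]
      split_ifs <;> omega
    · have e1 := ihs.eq_self x
      have e2 := iht.eq_self x
      simp only [size] at hx
      simp only [toFun]
      split_ifs <;> omega
    · have e1 := ihs.noncrossing x y
      have e2 := iht.noncrossing x y
      have := hs x
      have := ht x
      have := hs' x
      have := hs y
      have := ht y
      have := hs' y
      simp only [toFun]
      split_ifs <;> omega

/-- Every noncrossing involution comes from a path: the first step of the path is read off from the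
image of the left end of the interval. -/
theorem exists_toFun_eq {a n : ℕ} {f : ℕ → ℕ} (hf : IsNoncrossing a n f) :
    ∃ t : MotzkinTree, t.size = n ∧ toFun a t = f := by
  induction n using Nat.strong_induction_on generalizing a f with
  | _ n ih =>
    rcases n with _ | n
    · exact ⟨nil, rfl, hf.eq_id_of_zero.symm⟩
    have hm := hf.mapsTo (x := a) le_rfl (by omega)
    rcases hm.1.eq_or_lt with h | h
    · obtain ⟨t, h1, h2⟩ := ih n (by omega) (hf.tail h.symm)
      exact ⟨level t, by rw [size, h1], h2⟩
    · obtain ⟨s, hs1, hs2⟩ := ih _ (by omega) hf.inner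
      obtain ⟨t, ht1, ht2⟩ := ih _ (by omega) (hf.outer h)
      refine ⟨arc s t, by rw [size]; omega, funext fun x => ?_⟩
      have e : a + 1 + s.size = f a := by omega
      have e' : a + 2 + s.size = f a + 1 := by omega
      simp only [toFun, e, e', hs2, ht2]
      have e1 := hf.involutive a
      have e2 := hf.eq_self x
      split_ifs with h1 h2 <;> first | omega | (subst h1; rfl) | (rw [h2, e1])

theorem toFun_injective {a : ℕ} {t t' : MotzkinTree} (hsize : t.size = t'.size)
    (h : toFun a t = toFun a t') : t = t' := by
  have fixed (t : MotzkinTree) : toFun (a + 1) t a = a :=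
    (isNoncrossing_toFun (a + 1) t).eq_self a (by omega)
  induction t generalizing a t' with
  | nil => cases t' <;> simp_all [size]
  | level t ih =>
    cases t' with
    | nil => simp [size] at hsize
    | level t' => rw [ih (by simpa [size] using hsize) h fun t =>
        (isNoncrossing_toFun (a + 1 + 1) t).eq_self _ (by omega)]
    | arc s' t' =>
      have := congrFun h a
      simp only [toFun, if_true, fixed] at this
      omega
  | arc s t ihs iht =>
    cases t' with
    | nil => simp [size] at hsize
    | level t' =>
      have := congrFun h a
      simp only [toFun, if_true, fixed] at this
      omega
    | arc s' t' =>
      have h1 : s.size = s'.size := by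
        have := congrFun h a
        simp only [toFun, if_true] at this
        omega
      have h2 : t.size = t'.size := by
        simp only [size] at hsize
        omega
      rw [ihs (a := a + 1) h1 ?_ fun t => (isNoncrossing_toFun _ t).eq_self _ (by omega),
        iht (a := a + 2 + s.size) h2 ?_ fun t => (isNoncrossing_toFun _ t).eq_self _ (by omega)]
      · funext x
        have e1 := (isNoncrossing_toFun (a + 2 + s.size) t).eq_self x
        have e2 := (isNoncrossing_toFun (a + 2 + s.size) t').eq_self x
        have := congrFun h x
        simp only [toFun, ← h1] at this
        split_ifs at this <;> omega
      · funext x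
        have e1 := (isNoncrossing_toFun (a + 1) s).eq_self x
        have e2 := (isNoncrossing_toFun (a + 1) s').eq_self x
        have := congrFun h x
        simp only [toFun, ← h1] at this
        split_ifs at this <;> omega

end MotzkinTree

/-! ### Decreasing subsequences -/

open Classical in
/-- The generating polynomial, by cardinality, of the subsets of `A` on which `f` is strictly
decreasing. -/
noncomputable def decreasingPoly (f : ℕ → ℕ) (A : Finset ℕ) : Polynomial ℤ :=
  ∑ S ∈ A.powerset.filter (fun S : Finset ℕ => StrictAntiOn f S), Polynomial.X ^ S.card

theorem decreasingPoly_congr {f g : ℕ → ℕ} {A : Finset ℕ} (h : ∀ x ∈ A, f x = g x) :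
    decreasingPoly f A = decreasingPoly g A := by
  classical
  unfold decreasingPoly
  congr 1
  refine Finset.filter_congr fun S hS => ?_
  refine Set.EqOn.congr_strictAntiOn fun x hx => h x (Finset.mem_powerset.1 hS hx)

theorem decreasingPoly_empty (f : ℕ → ℕ) : decreasingPoly f ∅ = 1 := by
  classical
  simp [decreasingPoly, Finset.filter_singleton, StrictAntiOn]

/-- A nonempty decreasing subset lies in one of two blocks if the second block is above and to the
right of the first. The empty set is counted in both blocks. -/
theorem decreasingPoly_union {f : ℕ → ℕ} {A B : Finset ℕ}
    (h : ∀ x ∈ A, ∀ y ∈ B, x < y ∧ f x < f y) :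
    decreasingPoly f (A ∪ B) + 1 = decreasingPoly f A + decreasingPoly f B := by
  classical
  unfold decreasingPoly
  rw [← Finset.sum_union_inter]
  congr 1
  · congr 1
    ext S
    simp only [Finset.mem_filter, Finset.mem_powerset, Finset.mem_union, ← or_and_right]
    refine and_congr_left fun hS => ⟨fun hAB => ?_, fun h' => ?_⟩
    · by_contra hc
      rw [not_or, Finset.not_subset, Finset.not_subset] at hc
      obtain ⟨⟨y, hy, hyA⟩, x, hx, hxB⟩ := hc
      have hyB := (Finset.mem_union.1 (hAB hy)).resolve_left hyA
      have hxA := (Finset.mem_union.1 (hAB hx)).resolve_right hxB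
      have h1 := h x hxA y hyB
      exact lt_asymm h1.2 (hS hx hy h1.1)
    · rcases h' with h' | h'
      · exact h'.trans Finset.subset_union_left
      · exact h'.trans Finset.subset_union_right
  · have hdis : Disjoint A B := Finset.disjoint_left.2 fun x hA hB => (h x hA x hB).1.false
    have : A.powerset.filter (fun S : Finset ℕ => StrictAntiOn f S) ∩
        B.powerset.filter (fun S : Finset ℕ => StrictAntiOn f S) = {∅} := by
      ext S
      simp only [Finset.mem_inter, Finset.mem_filter, Finset.mem_powerset, Finset.mem_singleton]
      constructor
      · rintro ⟨⟨h1, _⟩, h2, _⟩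
        exact Finset.subset_empty.1 (hdis h1 h2)
      · rintro rfl
        simp [StrictAntiOn]
    rw [this, Finset.sum_singleton, Finset.card_empty, pow_zero]

/-- A point in decreasing position with respect to all points of `A` can be added to every
decreasing subset of `A`. -/
theorem decreasingPoly_insert {f : ℕ → ℕ} {A : Finset ℕ} {a : ℕ}
    (h : ∀ x ∈ A, (a < x ∧ f x < f a) ∨ (x < a ∧ f a < f x)) :
    decreasingPoly f (insert a A) = (1 + Polynomial.X) * decreasingPoly f A := by
  classical
  have ha : a ∉ A := fun ha => by
    have := h a ha
    omega
  unfold decreasingPoly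
  rw [Finset.sum_filter, Finset.sum_filter, Finset.sum_powerset_insert ha, add_mul, one_mul,
    Finset.mul_sum]
  congr 1
  refine Finset.sum_congr rfl fun S hS => ?_
  have hSA := Finset.mem_powerset.1 hS
  have key : StrictAntiOn f (insert a S : Finset ℕ) ↔ StrictAntiOn f (S : Set ℕ) := by
    refine ⟨fun h' => h'.mono (by simp), fun h' x hx y hy hxy => ?_⟩
    rw [Finset.coe_insert, Set.mem_insert_iff] at hx hy
    rcases hx with rfl | hx <;> rcases hy with rfl | hy
    · omega
    · have := h y (hSA hy)
      omega
    · have := h x (hSA hx)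
      omega
    · exact h' hx hy hxy
  rw [Finset.card_insert_of_notMem fun h' => ha (hSA h'), pow_succ']
  simp only [key, mul_ite, mul_zero]

namespace MotzkinTree

/-- The number of decreasing subsequences of length `m` which the path contributes when it starts
at height `h`: a fixed point inside `i` arcs contributes `C(2i, m-1)`, and an arc inside `i` other
arcs contributes `C(2i, m-1) + C(2i+1, m-1)`. -/
def cost (m : ℕ) : ℕ → MotzkinTree → ℕ
  | _, nil => 0
  | h, level t => (2 * h).choose (m - 1) + cost m h t
  | h, arc s t => (2 * h).choose (m - 1) + (2 * h + 1).choose (m - 1) + cost m (h + 1) s +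
      cost m h t

/-- The generating polynomial of the nonempty decreasing subsequences of the involution encoded by
a path. -/
noncomputable def costPoly : MotzkinTree → Polynomial ℤ
  | nil => 0
  | level t => Polynomial.X + costPoly t
  | arc s t => 2 * Polynomial.X + Polynomial.X ^ 2 + (1 + Polynomial.X) ^ 2 * costPoly s +
      costPoly t

theorem decreasingPoly_toFun (a : ℕ) (t : MotzkinTree) :
    decreasingPoly (toFun a t) (Finset.Ico a (a + t.size)) = 1 + costPoly t := by
  induction t generalizing a with
  | nil => simp [size, decreasingPoly_empty, costPoly]
  | level t ih =>
    have hN := isNoncrossing_toFun (a + 1) t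
    have hfix := hN.eq_self a (by omega)
    have e : Finset.Ico a (a + (level t).size) = {a} ∪ Finset.Ico (a + 1) (a + 1 + t.size) := by
      ext x
      simp only [Finset.mem_Ico, size, Finset.mem_union, Finset.mem_singleton]
      omega
    have e1 : decreasingPoly (toFun (a + 1) t) {a} = 1 + Polynomial.X := by
      rw [← insert_empty_eq, decreasingPoly_insert (by simp), decreasingPoly_empty, mul_one]
    apply add_right_cancel (b := 1)
    rw [e]
    change decreasingPoly (toFun (a + 1) t) _ + 1 = _
    rw [decreasingPoly_union, ih, e1, costPoly]
    · ring
    · intro x hx y hy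
      rw [Finset.mem_singleton] at hx
      rw [Finset.mem_Ico] at hy
      have := hN.mapsTo hy.1 hy.2
      subst hx
      omega
  | arc s t ihs iht =>
    have hs := isNoncrossing_toFun (a + 1) s
    have ht := isNoncrossing_toFun (a + 2 + s.size) t
    set f := toFun a (arc s t) with hf
    have f0 : f a = a + 1 + s.size := by simp [hf, toFun]
    have f1 : f (a + 1 + s.size) = a := by
      simp only [hf, toFun]
      split_ifs <;> omega
    have fs : ∀ x ∈ Finset.Ico (a + 1) (a + 1 + s.size), f x = toFun (a + 1) s x := by
      intro x hx
      rw [Finset.mem_Ico] at hx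
      simp only [hf, toFun]
      split_ifs <;> omega
    have ft : ∀ x ∈ Finset.Ico (a + 2 + s.size) (a + 2 + s.size + t.size),
        f x = toFun (a + 2 + s.size) t x := by
      intro x hx
      rw [Finset.mem_Ico] at hx
      simp only [hf, toFun]
      split_ifs <;> omega
    have e : Finset.Ico a (a + (arc s t).size) =
        insert a (insert (a + 1 + s.size) (Finset.Ico (a + 1) (a + 1 + s.size))) ∪
          Finset.Ico (a + 2 + s.size) (a + 2 + s.size + t.size) := by
      ext x
      simp only [Finset.mem_Ico, size, Finset.mem_union, Finset.mem_insert]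
      omega
    have rs : ∀ x ∈ Finset.Ico (a + 1) (a + 1 + s.size), a < f x ∧ f x < a + 1 + s.size := by
      intro x hx
      rw [fs x hx]
      rw [Finset.mem_Ico] at hx
      have := hs.mapsTo hx.1 hx.2
      omega
    apply add_right_cancel (b := 1)
    rw [e, decreasingPoly_union, decreasingPoly_insert, decreasingPoly_insert,
      decreasingPoly_congr fs, decreasingPoly_congr ft, ihs, iht, costPoly]
    · ring
    · intro x hx
      have := rs x hx
      rw [Finset.mem_Ico] at hx
      omega
    · intro x hx
      rw [Finset.mem_insert] at hx
      rcases hx with rfl | hx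
      · omega
      · have := rs x hx
        rw [Finset.mem_Ico] at hx
        omega
    · intro x hx y hy
      rw [ft y hy]
      rw [Finset.mem_Ico] at hy
      have := ht.mapsTo hy.1 hy.2
      rw [Finset.mem_insert, Finset.mem_insert] at hx
      rcases hx with rfl | rfl | hx
      · omega
      · omega
      · have := rs x hx
        rw [Finset.mem_Ico] at hx
        omega

/-- Raising a path by `h` puts `h` arcs around it, each of which multiplies the polynomial
by `(1 + X) ^ 2`. -/
theorem coeff_costPoly (m h : ℕ) (t : MotzkinTree) :
    ((1 + Polynomial.X) ^ (2 * h) * costPoly t).coeff (m + 1) =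
      (cost (m + 1) h t : ℤ) := by
  have hX (i : ℕ) : ((1 + Polynomial.X) ^ i * Polynomial.X : Polynomial ℤ).coeff (m + 1) =
      (i.choose m : ℤ) := by
    rw [Polynomial.coeff_mul_X, Polynomial.coeff_one_add_X_pow]
  induction t generalizing h with
  | nil => simp [costPoly, cost]
  | level t ih => 
    rw [costPoly, mul_add, Polynomial.coeff_add, hX, ih, cost, Nat.add_sub_cancel, Nat.cast_add]
  | arc s t ihs iht =>
    have e : (1 + Polynomial.X : Polynomial ℤ) ^ (2 * h) * (arc s t).costPoly =
        (1 + Polynomial.X) ^ (2 * h) * Polynomial.X +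
          (1 + Polynomial.X) ^ (2 * h + 1) * Polynomial.X +
          (1 + Polynomial.X) ^ (2 * (h + 1)) * costPoly s +
          (1 + Polynomial.X) ^ (2 * h) * costPoly t := by
      rw [costPoly]
      ring
    rw [e, Polynomial.coeff_add, Polynomial.coeff_add, Polynomial.coeff_add, hX, hX, ihs, iht, cost,
      Nat.add_sub_cancel]
    push_cast
    rfl

theorem coeff_decreasingPoly_toFun {m : ℕ} (hm : 1 ≤ m) (t : MotzkinTree) :
    (decreasingPoly (toFun 0 t) (Finset.range t.size)).coeff m = (cost m 0 t : ℤ) := by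
  obtain ⟨m, rfl⟩ := Nat.exists_eq_add_of_le' hm
  have h := decreasingPoly_toFun 0 t
  rw [zero_add, ← Finset.range_eq_Ico] at h
  rw [h, Polynomial.coeff_add, ← coeff_costPoly]
  simp [Polynomial.coeff_one]

end MotzkinTree

/-! ### Involutions that avoid `3412` -/

/-- The permutation `π` of `{0, …, n - 1}` as a function on `ℕ` that fixes all `x ≥ n`. -/
def extendToNat {n : ℕ} (π : Equiv.Perm (Fin n)) (x : ℕ) : ℕ :=
  if h : x < n then (π ⟨x, h⟩ : ℕ) else x

theorem extendToNat_val {n : ℕ} (π : Equiv.Perm (Fin n)) (i : Fin n) :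
    extendToNat π i = π i := by
  simp [extendToNat]

theorem extendToNat_of_le {n : ℕ} (π : Equiv.Perm (Fin n)) {x : ℕ} (h : n ≤ x) :
    extendToNat π x = x := by
  rw [extendToNat, dif_neg (by omega)]

theorem extendToNat_injective (n : ℕ) :
    Function.Injective (extendToNat : Equiv.Perm (Fin n) → ℕ → ℕ) := by
  intro π π' h
  ext i
  rw [← extendToNat_val, ← extendToNat_val, h]

/-- An occurrence of `3412` in an involution yields two crossing arcs, and two crossing arcs
`x < y < π x < π y` are an occurrence of `3412`. -/
theorem avoids_pattern3412_iff {n : ℕ} {π : Equiv.Perm (Fin n)} (hπ : Function.Involutive π) :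
    Avoids π pattern3412 ↔ ∀ x y, ¬(x < y ∧ y < π x ∧ π x < π y) := by
  constructor
  · rintro h x y ⟨h1, h2, h3⟩
    have hmono : StrictMono ![x, y, π x, π y] := by
      refine Fin.strictMono_iff_lt_succ.2 fun i => ?_
      fin_cases i
      · exact h1
      · exact h2
      · exact h3
    have hmem : OrderEmbedding.ofStrictMono _ hmono ∈ subsequencesOfType pattern3412 π := by
      intro i j
      have e1 := hπ x
      have e2 := hπ y
      fin_cases i <;> fin_cases j <;> simp [pattern3412, e1, e2] <;> order
    rw [Avoids] at h
    rw [h] at hmem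
    exact hmem
  · intro h
    refine Set.eq_empty_iff_forall_notMem.2 fun f hf => ?_
    have hm (i j : Fin 4) (hij : i < j) : f i < f j := f.strictMono hij
    have h01 := hm 0 1 (by decide)
    have h12 := hm 1 2 (by decide)
    have h23 := hm 2 3 (by decide)
    have p23 : π (f 2) < π (f 3) := (hf 2 3).2 (by decide)
    have p30 : π (f 3) < π (f 0) := (hf 3 0).2 (by decide)
    have p01 : π (f 0) < π (f 1) := (hf 0 1).2 (by decide)
    -- If `π (f 0) > f 0`, the arcs at `f 0` and `f 1` cross or `π (f 0) ≤ f 1`; then, and also if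
    -- `π (f 0) ≤ f 0`, the arcs that end at `f 2` and `f 3` cross.
    have c1 := h (f 0) (f 1)
    have c2 := h (π (f 2)) (π (f 3))
    rw [hπ, hπ] at c2
    omega

theorem isNoncrossing_extendToNat_iff {n : ℕ} {π : Equiv.Perm (Fin n)} :
    IsNoncrossing 0 n (extendToNat π) ↔ Function.Involutive π ∧ Avoids π pattern3412 := by
  constructor
  · intro h
    have hinv : Function.Involutive π := fun i => by
      ext
      rw [← extendToNat_val, ← extendToNat_val, h.involutive]
    refine ⟨hinv, (avoids_pattern3412_iff hinv).2 fun x y => ?_⟩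
    have := h.noncrossing x y
    rwa [extendToNat_val, extendToNat_val] at this
  · rintro ⟨hinv, h⟩
    rw [avoids_pattern3412_iff hinv] at h
    refine ⟨fun x => ?_, fun x hx => extendToNat_of_le π (by omega), ?_⟩
    · rcases Nat.lt_or_ge x n with hx | hx
      · have := extendToNat_val π ⟨x, hx⟩
        dsimp only at this
        rw [this, extendToNat_val, hinv]
      · rw [extendToNat_of_le π hx, extendToNat_of_le π hx]
    · rintro x y ⟨h1, h2, h3⟩
      have hx : x < n := by
        by_contra hx
        rw [extendToNat_of_le π (by omega)] at h2
        omega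
      have e1 := extendToNat_val π ⟨x, hx⟩
      dsimp only at e1
      rw [e1] at h2 h3
      have hy : y < n := by omega
      have e2 := extendToNat_val π ⟨y, hy⟩
      dsimp only at e2
      rw [e2] at h3
      exact h ⟨x, hx⟩ ⟨y, hy⟩ ⟨h1, h2, h3⟩

theorem exists_extendToNat_eq {n : ℕ} {f : ℕ → ℕ} (hf : IsNoncrossing 0 n f) :
    ∃ π : Equiv.Perm (Fin n), extendToNat π = f := by
  have hlt (i : Fin n) : f i < n := by
    have := hf.mapsTo (x := i) (by omega) (by omega)
    omega
  have hinv : Function.Involutive fun i : Fin n => (⟨f i, hlt i⟩ : Fin n) := fun i => by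
    ext
    exact hf.involutive i
  refine ⟨hinv.toPerm, funext fun x => ?_⟩
  rcases Nat.lt_or_ge x n with hx | hx
  · exact extendToNat_val hinv.toPerm ⟨x, hx⟩
  · rw [extendToNat_of_le _ hx, hf.eq_self x (by omega)]

/-- A decreasing subsequence is determined by its set of positions. -/
theorem ncard_subsequencesOfType_decreasingPattern (m : ℕ) {n : ℕ} (π : Equiv.Perm (Fin n)) :
    ((subsequencesOfType (decreasingPattern m) π).ncard : ℤ) =
      (decreasingPoly (extendToNat π) (Finset.range n)).coeff m := by
  classical
  let Φ : (Fin m ↪o Fin n) → Finset ℕ := fun e =>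
    Finset.univ.map (e.toEmbedding.trans Fin.valEmbedding)
  have hΦmem (e : Fin m ↪o Fin n) (x : ℕ) : x ∈ Φ e ↔ ∃ i, (e i : ℕ) = x := by simp [Φ]
  have hΦ : Function.Injective Φ := by
    intro e e' h
    have hr : Set.range e = Set.range e' := by
      ext x
      have := congrArg (fun S => (x : ℕ) ∈ S) h
      simpa only [hΦmem, Fin.val_inj, eq_iff_iff, Set.mem_range] using this
    exact DFunLike.coe_injective ((e.strictMono.range_inj e'.strictMono).1 hr)
  have himage : Φ '' subsequencesOfType (decreasingPattern m) π =
      ((Finset.range n).powerset.filter fun S : Finset ℕ =>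
        StrictAntiOn (extendToNat π) S ∧ S.card = m : Finset (Finset ℕ)) := by
    ext S
    simp only [Set.mem_image, Finset.coe_filter, Finset.mem_powerset, Set.mem_ofPred_eq]
    constructor
    · rintro ⟨e, he, rfl⟩
      refine ⟨fun x hx => ?_, fun x hx y hy hxy => ?_, by simp [Φ]⟩
      · obtain ⟨i, rfl⟩ := (hΦmem e x).1 hx
        exact Finset.mem_range.2 (e i).2
      · obtain ⟨i, rfl⟩ := (hΦmem e x).1 hx
        obtain ⟨j, rfl⟩ := (hΦmem e y).1 hy
        rw [extendToNat_val, extendToNat_val, Fin.val_fin_lt]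
        refine (he j i).2 ?_
        rw [decreasingPattern, Fin.revPerm_apply, Fin.revPerm_apply, Fin.rev_lt_rev]
        exact e.lt_iff_lt.1 hxy
    · rintro ⟨hS, hanti, hcard⟩
      have hlt (i : Fin m) : S.orderEmbOfFin hcard i < n :=
        Finset.mem_range.1 (hS (Finset.orderEmbOfFin_mem S hcard i))
      let e : Fin m ↪o Fin n := OrderEmbedding.ofStrictMono
        (fun i => ⟨S.orderEmbOfFin hcard i, hlt i⟩) fun i j hij =>
          (S.orderEmbOfFin hcard).strictMono hij
      have hval (i : Fin m) : ((e i : Fin n) : ℕ) = S.orderEmbOfFin hcard i := rfl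
      have hmem (i : Fin m) : ((e i : Fin n) : ℕ) ∈ (S : Set ℕ) :=
        Finset.orderEmbOfFin_mem S hcard i
      refine ⟨e, fun i j => ?_, ?_⟩
      · rw [decreasingPattern, Fin.revPerm_apply, Fin.revPerm_apply, Fin.rev_lt_rev,
          ← e.lt_iff_lt, ← Fin.val_fin_lt, ← Fin.val_fin_lt, ← extendToNat_val, ← extendToNat_val]
        exact hanti.lt_iff_gt (hmem i) (hmem j)
      · ext x
        rw [hΦmem]
        have := Set.ext_iff.1 (Finset.range_orderEmbOfFin S hcard) x
        exact this
  rw [← Set.ncard_image_of_injective _ hΦ, himage, Set.ncard_coe_finset, decreasingPoly,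
    Polynomial.finsetSum_coeff]
  simp only [Polynomial.coeff_X_pow, Finset.sum_boole, Finset.filter_filter, eq_comm]

open Classical in
/-- Counting involutions amounts to counting Motzkin paths by their cost. -/
theorem ncard_involutionsWith {m : ℕ} (hm : 1 ≤ m) (r n : ℕ) :
    (involutionsWith m r n).ncard =
      ((MotzkinTree.ofSize n).filter fun t => MotzkinTree.cost m 0 t = r).card := by
  have h : extendToNat '' involutionsWith m r n = MotzkinTree.toFun 0 ''
      ((MotzkinTree.ofSize n).filter fun t => MotzkinTree.cost m 0 t = r :
        Finset MotzkinTree) := by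
    ext f
    simp only [Set.mem_image, Finset.coe_filter, MotzkinTree.mem_ofSize, Set.mem_ofPred_eq,
      involutionsWith]
    constructor
    · rintro ⟨π, ⟨h1, h2, h3⟩, rfl⟩
      obtain ⟨t, rfl, ht⟩ :=
        MotzkinTree.exists_toFun_eq (isNoncrossing_extendToNat_iff.2 ⟨h1, h2⟩)
      refine ⟨t, ⟨rfl, ?_⟩, ht⟩
      have := ncard_subsequencesOfType_decreasingPattern m π
      rw [← ht, MotzkinTree.coeff_decreasingPoly_toFun hm, h3] at this
      exact_mod_cast this.symm
    · rintro ⟨t, ⟨rfl, hr⟩, rfl⟩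
      have hN := MotzkinTree.isNoncrossing_toFun 0 t
      obtain ⟨π, hπ⟩ := exists_extendToNat_eq hN
      rw [← hπ, isNoncrossing_extendToNat_iff] at hN
      refine ⟨π, ⟨hN.1, hN.2, ?_⟩, hπ⟩
      have := ncard_subsequencesOfType_decreasingPattern m π
      rw [hπ, MotzkinTree.coeff_decreasingPoly_toFun hm, hr] at this
      exact_mod_cast this
  rw [← Set.ncard_image_of_injective _ (extendToNat_injective n), h, Set.InjOn.ncard_image,
    Set.ncard_coe_finset]
  intro t ht t' ht' htt'
  simp only [Finset.coe_filter, MotzkinTree.mem_ofSize, Set.mem_ofPred_eq] at ht ht'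
  exact MotzkinTree.toFun_injective (ht.1.trans ht'.1.symm) htt'

/-! ### Expansion of the continued fraction -/

/-- The polynomials `x ^ (n - 1) U_{n-1}((1 - x) / (2 x))`, where `U` denotes the Chebyshev
polynomials of the second kind; see `xL_mul_heightPoly`. They are the numerators and denominators
of the generating functions of Motzkin paths of bounded height. -/
def heightPoly {R : Type*} [CommRing R] (x : R) : ℕ → R
  | 0 => 0
  | 1 => 1
  | n + 2 => (1 - x) * heightPoly x (n + 1) - x ^ 2 * heightPoly x n

section ContinuedFraction

variable {R : Type*} [CommRing R]

theorem map_heightPoly {S : Type*} [CommRing S] (φ : R →+* S) (x : R) (n : ℕ) :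
    φ (heightPoly x n) = heightPoly (φ x) n := by
  induction n using Nat.twoStepInduction with
  | zero => simp [heightPoly]
  | one => simp [heightPoly]
  | more n ih1 ih2 => simp [heightPoly, ih1, ih2]

theorem heightPoly_sq_sub (x : R) (n : ℕ) :
    heightPoly x (n + 1) ^ 2 - heightPoly x n * heightPoly x (n + 2) = x ^ (2 * n) := by
  induction n with
  | zero => simp [heightPoly]
  | succ n ih =>
    rw [show 2 * (n + 1) = 2 * n + 2 by ring, pow_add, ← ih,
      show heightPoly x (n + 1 + 2) = (1 - x) * heightPoly x (n + 2) - x ^ 2 * heightPoly x (n + 1)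
        from rfl, show heightPoly x (n + 2) = (1 - x) * heightPoly x (n + 1) -
        x ^ 2 * heightPoly x n from rfl]
    ring

/-- The first `j + 1` levels of the continued fraction, on which the weights are `x` and `x ^ 2`
except for the last up step, form a linear fractional function of the rest of the fraction. -/
theorem mul_heightPoly_sub {x : R} {j : ℕ} {A B Z : ℕ → R}
    (hZ : ∀ h, Z h * (1 - (A h + B h * Z (h + 1))) = 1)
    (hA : ∀ h ≤ j, A h = x) (hB : ∀ h < j, B h = x ^ 2) :
    Z 0 * (heightPoly x (j + 2) - heightPoly x (j + 1) * (B j * Z (j + 1))) =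
      heightPoly x (j + 1) - heightPoly x j * (B j * Z (j + 1)) := by
  induction j generalizing A B Z with
  | zero =>
    have h0 := hZ 0
    rw [hA 0 le_rfl] at h0
    simp only [heightPoly]
    linear_combination h0
  | succ j ih =>
    have h1 := ih (A := fun h => A (h + 1)) (B := fun h => B (h + 1)) (Z := fun h => Z (h + 1))
      (fun h => hZ (h + 1)) (fun h hh => hA (h + 1) (by omega)) (fun h hh => hB (h + 1) (by omega))
    have h0 := hZ 0
    rw [hA 0 (by omega), hB 0 (by omega)] at h0
    simp only [zero_add] at h0 h1
    rw [show heightPoly x (j + 1 + 2) = (1 - x) * heightPoly x (j + 2) -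
      x ^ 2 * heightPoly x (j + 1) from rfl]
    have e : heightPoly x (j + 1 + 1) = (1 - x) * heightPoly x (j + 1) - x ^ 2 * heightPoly x j :=
      rfl
    have e' : heightPoly x (j + 1 + 1) = heightPoly x (j + 2) := rfl
    rw [e'] at e ⊢
    linear_combination (heightPoly x (j + 2) - heightPoly x (j + 1) * (B (j + 1) * Z (j + 2))) * h0
      + Z 0 * x ^ 2 * h1 - Z 0 * B (j + 1) * Z (j + 2) * e

/-- The coefficients of the expansion of a linear fractional function with denominator `c - d y`
and determinant `δ` in powers of `y`, apart from the constant one; here `c'` is the inverse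
of `c`. -/
def fractionCoeff (δ c' d : R) (n : ℕ) : R :=
  if n = 0 then 0 else δ * d ^ (n - 1) * c' ^ (n + 1)

theorem eq_sum_fractionCoeff {z a b c c' d y : R} (h : z * (c - d * y) = a - b * y)
    (hc : c * c' = 1) {N : ℕ} (hy : y ^ (N + 1) = 0) :
    z = a * c' + ∑ n ∈ Finset.range (N + 1), fractionCoeff (a * d - b * c) c' d n * y ^ n := by
  -- The truncated geometric series inverts `c - d y` because `y` is nilpotent.
  have hgeom : (∑ n ∈ Finset.range (N + 1), d ^ n * c' ^ (n + 1) * y ^ n) * (c - d * y) = 1 := by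
    have h1 := geom_sum_mul_neg (d * c' * y) (N + 1)
    rw [mul_pow, hy, mul_zero, sub_zero] at h1
    rw [← h1, Finset.sum_mul, Finset.sum_mul]
    refine Finset.sum_congr rfl fun n _ => ?_
    linear_combination (d ^ n * c' ^ n * y ^ n) * hc
  have hsum : ∑ n ∈ Finset.range (N + 1), fractionCoeff (a * d - b * c) c' d n * y ^ n =
      (a * d - b * c) * c' * y * ∑ n ∈ Finset.range (N + 1), d ^ n * c' ^ (n + 1) * y ^ n := by
    rw [Finset.sum_range_succ', Finset.sum_range_succ, mul_add]
    have h2 : (a * d - b * c) * c' * y * (d ^ N * c' ^ (N + 1) * y ^ N) = 0 := by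
      linear_combination ((a * d - b * c) * c' * d ^ N * c' ^ (N + 1)) * hy
    rw [h2, Finset.mul_sum]
    simp only [fractionCoeff, if_true, Nat.succ_ne_zero, if_false, zero_mul]
    congr 1
    refine Finset.sum_congr rfl fun n _ => ?_
    rw [Nat.add_sub_cancel]
    ring
  rw [hsum]
  set V := ∑ n ∈ Finset.range (N + 1), d ^ n * c' ^ (n + 1) * y ^ n
  linear_combination (-z + a * c') * hgeom + V * h - V * (a - b * y) * hc

/-- The truncated binomial series for exponents `-(d + 1)` and `-d` differ by a factor `1 - u`, up to
a multiple of `u ^ (N + 1)`. -/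
theorem sum_choose_mul_one_sub (u : R) (d N : ℕ) :
    (∑ n ∈ Finset.range (N + 1), ((d + n).choose n : R) * u ^ n) * (1 - u) =
      ∑ n ∈ Finset.range (N + 1), ((d + n - 1).choose n : R) * u ^ n -
        ((d + N).choose N : R) * u ^ (N + 1) := by
  induction N with
  | zero => simp
  | succ N ih =>
    rw [Finset.sum_range_succ, Finset.sum_range_succ _ (N + 1), add_mul, ih]
    have h : ((d + (N + 1)).choose (N + 1) : R) =
        (d + N).choose N + (d + (N + 1) - 1).choose (N + 1) := by
      rw [show d + (N + 1) - 1 = d + N by omega, ← add_assoc, Nat.choose_succ_succ]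
      push_cast
      rfl
    rw [h]
    ring

/-- The binomial series for `(1 - u) ^ (-d)` with `u` nilpotent. -/
theorem pow_eq_sum_choose {z u : R} (hz : z * (1 - u) = 1) {N : ℕ} (hu : u ^ (N + 1) = 0)
    (d : ℕ) : z ^ d = ∑ n ∈ Finset.range (N + 1), ((d + n - 1).choose n : R) * u ^ n := by
  induction d with
  | zero =>
    rw [Finset.sum_range_succ', Finset.sum_eq_zero]
    · simp
    · intro n _
      rw [Nat.choose_eq_zero_of_lt (by omega), Nat.cast_zero, zero_mul]
  | succ d ih =>
    have h := sum_choose_mul_one_sub u d N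
    rw [hu, mul_zero, sub_zero, ← ih] at h
    have e (n : ℕ) : d + 1 + n - 1 = d + n := by omega
    simp only [e]
    rw [pow_succ, ← h]
    linear_combination (∑ n ∈ Finset.range (N + 1), ((d + n).choose n : R) * u ^ n) * hz

/-- The binomial series for `(1 - (u + v)) ^ (-d)`, expanded in powers of `u` and `v`. This is one
level of the continued fraction. -/
theorem pow_eq_sum_sum_choose {z u v : R} (hz : z * (1 - (u + v)) = 1) {N : ℕ}
    (huv : ∀ l e, N + 1 ≤ l + e → u ^ l * v ^ e = 0) (d : ℕ) :
    z ^ d = ∑ l ∈ Finset.range (N + 1), ∑ e ∈ Finset.range (N + 1),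
      (((d + e + l - 1).choose (e + l) * (e + l).choose l : ℕ) : R) * (u ^ l * v ^ e) := by
  have hpow (n : ℕ) : (u + v) ^ n = ∑ p ∈ Finset.HasAntidiagonal.antidiagonal n,
      (n.choose p.1 : R) * (u ^ p.1 * v ^ p.2) := by
    rw [(Commute.all u v).add_pow']
    simp only [nsmul_eq_mul]
  have hnil : (u + v) ^ (N + 1) = 0 := by
    rw [hpow]
    refine Finset.sum_eq_zero fun p hp => ?_
    rw [huv _ _ (Finset.HasAntidiagonal.mem_antidiagonal.1 hp).ge, mul_zero]
  rw [pow_eq_sum_choose hz hnil, ← Finset.sum_product', 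
    ← Finset.sum_filter_of_ne (p := fun p : ℕ × ℕ => p.1 + p.2 < N + 1),
    ← Finset.sum_fiberwise_of_maps_to (g := fun p : ℕ × ℕ => p.1 + p.2)
      (t := Finset.range (N + 1))]
  · refine Finset.sum_congr rfl fun n hn => ?_
    rw [Finset.mem_range] at hn
    rw [hpow, Finset.mul_sum]
    refine Finset.sum_congr ?_ fun p hp => ?_
    · ext p
      simp only [Finset.HasAntidiagonal.mem_antidiagonal, Finset.mem_filter, Finset.mem_product,
        Finset.mem_range]
      omega
    · have h : p.1 + p.2 = n := (Finset.mem_filter.1 hp).2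
      rw [add_assoc, add_comm p.2, h]
      push_cast
      ring
  · intro p hp
    exact Finset.mem_range.2 (Finset.mem_filter.1 hp).2
  · intro p _ hne
    by_contra hp
    rw [huv _ _ (not_lt.1 hp), mul_zero] at hne
    exact hne rfl

theorem sum_piFinset_cons {M : Type*} [AddCommMonoid M] (s : Finset ℕ) (b : ℕ)
    (g : (Fin (b + 1) → ℕ) → M) :
    ∑ f ∈ Fintype.piFinset fun _ : Fin (b + 1) => s, g f =
      ∑ x ∈ s, ∑ f ∈ Fintype.piFinset fun _ : Fin b => s, g (Fin.cons x f) := by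
  rw [← Finset.sum_product']
  refine (Finset.sum_bij' (fun p _ => (Fin.cons p.1 p.2 : Fin (b + 1) → ℕ))
    (fun f _ => (f 0, Fin.tail f)) ?_ ?_ ?_ ?_ ?_).symm
  · intro p hp
    rw [Finset.mem_product, Fintype.mem_piFinset] at hp
    rw [Fintype.mem_piFinset]
    exact Fin.cases hp.1 hp.2
  · intro f hf
    rw [Fintype.mem_piFinset] at hf
    rw [Finset.mem_product, Fintype.mem_piFinset]
    exact ⟨hf 0, fun i => hf i.succ⟩
  · intro p _
    simp
  · intro f _
    simp
  · intro p _
    rfl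

theorem nextEntry_cons_zero {b : ℕ} (x : ℕ) (d : Fin (b + 1) → ℕ) :
    nextEntry (Fin.cons x d : Fin (b + 2) → ℕ) 0 = d 0 := by
  rw [nextEntry, dif_pos (by simp)]
  rfl

theorem nextEntry_cons_succ {b : ℕ} (x : ℕ) (d : Fin (b + 1) → ℕ) (i : Fin (b + 1)) :
    nextEntry (Fin.cons x d : Fin (b + 2) → ℕ) i.succ = nextEntry d i := by
  simp only [nextEntry, Fin.val_succ, Nat.add_lt_add_iff_right]
  rfl

theorem nextEntry_last (d : Fin 1 → ℕ) : nextEntry d 0 = 0 := by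
  simp [nextEntry]

theorem binomialWeight_cons {b : ℕ} (x y : ℕ) (d l : Fin (b + 1) → ℕ) :
    binomialWeight (Fin.cons x d : Fin (b + 2) → ℕ) (Fin.cons y l) =
      (x + d 0 + y - 1).choose (d 0 + y) * (d 0 + y).choose y * binomialWeight d l := by
  rw [binomialWeight, Fin.prod_univ_succ]
  simp only [nextEntry_cons_zero, nextEntry_cons_succ, Fin.cons_zero, Fin.cons_succ]
  rfl

/-- The expansion of a power of a finite continued fraction with nilpotent entries. -/
theorem pow_eq_sum_binomialWeight {N : ℕ} (b : ℕ) {A B Z : ℕ → R}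
    (hZ : ∀ h, Z h * (1 - (A h + B h * Z (h + 1))) = 1)
    (hAB : ∀ h l e, N + 1 ≤ l + e → A h ^ l * B h ^ e = 0) (hB : B b = 0) (n : ℕ) :
    Z 0 ^ n = ∑ l ∈ Fintype.piFinset fun _ : Fin (b + 1) => Finset.range (N + 1),
      ∑ d ∈ Fintype.piFinset fun _ : Fin b => Finset.range (N + 1),
        (binomialWeight (Fin.cons n d : Fin (b + 1) → ℕ) l : R) *
          ∏ i : Fin (b + 1), (A i ^ l i * B i ^ nextEntry (Fin.cons n d : Fin (b + 1) → ℕ) i) := by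
  induction b generalizing A B Z n with
  | zero =>
    rw [pow_eq_sum_sum_choose (hZ 0) (fun l e h => by
      rw [mul_pow, ← mul_assoc, hAB 0 l e h, zero_mul]) n, sum_piFinset_cons]
    refine Finset.sum_congr rfl fun x _ => ?_
    rw [Finset.sum_range_succ', Finset.sum_eq_zero]
    · simp [binomialWeight, nextEntry_last]
    · intro e _
      rw [hB]
      simp
  | succ b ih =>
    rw [pow_eq_sum_sum_choose (hZ 0) (fun l e h => by
      rw [mul_pow, ← mul_assoc, hAB 0 l e h, zero_mul]) n, sum_piFinset_cons]
    refine Finset.sum_congr rfl fun x _ => ?_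
    refine Eq.trans ?_ (Finset.sum_congr rfl fun l _ => (sum_piFinset_cons _ b _).symm)
    rw [Finset.sum_comm]
    refine Finset.sum_congr rfl fun e _ => ?_
    have h1 := ih (A := fun h => A (h + 1)) (B := fun h => B (h + 1)) (Z := fun h => Z (h + 1))
      (fun h => hZ (h + 1)) (fun h => hAB (h + 1)) hB e
    rw [mul_pow, h1, Finset.mul_sum, Finset.mul_sum, Finset.mul_sum]
    refine Finset.sum_congr rfl fun l _ => ?_
    rw [Finset.mul_sum, Finset.mul_sum, Finset.mul_sum]
    refine Finset.sum_congr rfl fun d _ => ?_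
    rw [binomialWeight_cons, Fin.prod_univ_succ (n := b + 1)]
    simp only [nextEntry_cons_zero, nextEntry_cons_succ, Fin.cons_zero, Fin.cons_succ,
      Fin.val_zero, Fin.val_succ]
    push_cast
    ring

theorem pow_mul_prod_nextEntry {b : ℕ} (B : ℕ → R) (d : Fin (b + 1) → ℕ) :
    B 0 ^ d 0 * ∏ i : Fin (b + 1), B (i + 1) ^ nextEntry d i =
      ∏ i : Fin (b + 1), B i ^ d i := by
  rw [Fin.prod_univ_succ (fun i : Fin (b + 1) => B i ^ d i), Fin.prod_univ_castSucc]
  have h1 : nextEntry d (Fin.last b) = 0 := by simp [nextEntry]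
  have h2 (i : Fin b) : nextEntry d i.castSucc = d i.succ := by
    simp only [nextEntry, Fin.val_castSucc]
    rw [dif_pos (by omega)]
    rfl
  simp only [h1, h2, pow_zero, mul_one, Fin.val_castSucc, Fin.val_succ, Fin.val_zero]

/-- The expansion of a continued fraction which starts with `j + 1` constant levels and goes on with
finitely many levels with nilpotent entries. -/
theorem continuedFraction_eq_sum {N b j : ℕ} {x c' : R} {A B Z : ℕ → R}
    (hZ : ∀ h, Z h * (1 - (A h + B h * Z (h + 1))) = 1)
    (hA : ∀ h ≤ j, A h = x) (hB : ∀ h < j, B h = x ^ 2)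
    (hAB : ∀ h l e, N + 1 ≤ l + e → A (j + 1 + h) ^ l * B (j + 1 + h) ^ e = 0)
    (hBj : B j ^ (N + 1) = 0) (hBb : B (j + 1 + b) = 0) (hc : heightPoly x (j + 2) * c' = 1) :
    Z 0 = heightPoly x (j + 1) * c' +
      ∑ d ∈ Fintype.piFinset fun _ : Fin (b + 1) => Finset.range (N + 1),
      ∑ l ∈ Fintype.piFinset fun _ : Fin (b + 1) => Finset.range (N + 1),
        fractionCoeff (x ^ (2 * j)) c' (heightPoly x (j + 1)) (d 0) * (binomialWeight d l : R) *
          ((∏ i : Fin (b + 1), B (j + i) ^ d i) * ∏ i : Fin (b + 1), A (j + 1 + i) ^ l i) := by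
  have h1 := eq_sum_fractionCoeff (mul_heightPoly_sub hZ hA hB) hc (N := N)
    (by rw [mul_pow, hBj, zero_mul])
  rw [show heightPoly x (j + 1) * heightPoly x (j + 1) - heightPoly x j * heightPoly x (j + 2) =
    x ^ (2 * j) by rw [← heightPoly_sq_sub, sq]] at h1
  rw [h1, sum_piFinset_cons]
  congr 1
  refine Finset.sum_congr rfl fun n _ => ?_
  have h2 := pow_eq_sum_binomialWeight b (A := fun h => A (j + 1 + h)) (B := fun h => B (j + 1 + h))
    (Z := fun h => Z (j + 1 + h)) (fun h => hZ (j + 1 + h)) hAB hBb n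
  rw [add_zero] at h2
  rw [mul_pow, h2, Finset.sum_comm, Finset.mul_sum, Finset.mul_sum]
  refine Finset.sum_congr rfl fun d _ => ?_
  rw [Finset.mul_sum, Finset.mul_sum]
  refine Finset.sum_congr rfl fun l _ => ?_
  have h3 := pow_mul_prod_nextEntry (fun h => B (j + h)) (Fin.cons n d : Fin (b + 1) → ℕ)
  have e (i : Fin (b + 1)) : j + ((i : ℕ) + 1) = j + 1 + i := by omega
  simp only [e, add_zero, Fin.cons_zero] at h3
  rw [← h3, Finset.prod_mul_distrib]
  simp only [Fin.cons_zero]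
  ring

end ContinuedFraction

/-! ### The generating function of the involutions as a power series -/

/-- The exponents of the weights add up to the cost of the path. -/
theorem MotzkinTree.weight_X_pow (m h : ℕ) (t : MotzkinTree) :
    weight (fun i => (Polynomial.X : Polynomial ℚ) ^ (2 * i).choose (m - 1))
      (fun i => Polynomial.X ^ ((2 * i).choose (m - 1) + (2 * i + 1).choose (m - 1))) h t =
      Polynomial.X ^ cost m h t := by
  induction t generalizing h with
  | nil => simp [weight, cost]
  | level t ih => rw [weight, ih, cost, pow_add]
  | arc s t ihs iht => rw [weight, ihs, iht, cost, pow_add _ _ (cost m h t), pow_add _ _ (cost m _ s)]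

/-- The generating function of Motzkin paths in which a second variable marks the cost. -/
noncomputable def costGF (m h : ℕ) : PowerSeries (Polynomial ℚ) :=
  MotzkinTree.weightGF (fun i => Polynomial.X ^ (2 * i).choose (m - 1))
    (fun i => Polynomial.X ^ ((2 * i).choose (m - 1) + (2 * i + 1).choose (m - 1))) h

theorem coeff_coeff_costGF {m : ℕ} (hm : 1 ≤ m) (r n : ℕ) :
    (PowerSeries.coeff n (costGF m 0)).coeff r = PowerSeries.coeff n (involutionGF m r) := by
  classical
  rw [costGF, MotzkinTree.weightGF, PowerSeries.coeff_mk, involutionGF, PowerSeries.coeff_mk,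
    ncard_involutionsWith hm, Polynomial.finsetSum_coeff]
  simp only [MotzkinTree.weight_X_pow, Polynomial.coeff_X_pow, Finset.sum_boole, eq_comm]

theorem coeff_coeff_map_C_mul (f : PowerSeries ℚ) (c r n : ℕ) :
    (PowerSeries.coeff n (PowerSeries.map Polynomial.C f *
      PowerSeries.C (Polynomial.X ^ c))).coeff r = if r = c then PowerSeries.coeff n f else 0 := by
  rw [PowerSeries.coeff_mul_C, PowerSeries.coeff_map, Polynomial.coeff_C_mul, Polynomial.coeff_X_pow,
    mul_ite, mul_one, mul_zero]

theorem constantCoeff_heightPoly_X (n : ℕ) :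
    PowerSeries.constantCoeff (heightPoly (PowerSeries.X : PowerSeries ℚ) (n + 1)) = 1 := by
  induction n using Nat.twoStepInduction with
  | zero => simp [heightPoly]
  | one => simp [heightPoly]
  | more n _ ih => rw [heightPoly]; simp [ih]

theorem map_fractionCoeff {R S : Type*} [CommRing R] [CommRing S] (φ : R →+* S) (δ c' d : R)
    (n : ℕ) : φ (fractionCoeff δ c' d n) = fractionCoeff (φ δ) (φ c') (φ d) n := by
  simp only [fractionCoeff, apply_ite φ, map_mul, map_pow, map_zero]

/-- The right hand side of the equation that defines `indexSet`: the total cost of the steps of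
height at least `k - 1` of a Motzkin path. -/
def indexCost (k : ℕ) {b : ℕ} (d l : Fin (b + 1) → ℕ) : ℕ :=
  ∑ i : Fin (b + 1), d i * ((2 * k + 2 * (i : ℕ) - 2).choose (2 * k - 1) +
    (2 * k + 2 * (i : ℕ) - 1).choose (2 * k - 1)) +
  ∑ i : Fin (b + 1), l i * (2 * k + 2 * (i : ℕ)).choose (2 * k - 1)

theorem le_indexCost {k b : ℕ} (hk : 1 ≤ k) (d l : Fin (b + 1) → ℕ) (i : Fin (b + 1)) :
    d i ≤ indexCost k d l ∧ l i ≤ indexCost k d l := by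
  have h1 := Finset.single_le_sum (f := fun i : Fin (b + 1) =>
    d i * ((2 * k + 2 * (i : ℕ) - 2).choose (2 * k - 1) +
      (2 * k + 2 * (i : ℕ) - 1).choose (2 * k - 1)))
    (fun _ _ => Nat.zero_le _) (Finset.mem_univ i)
  have h2 := Finset.single_le_sum (f := fun i : Fin (b + 1) =>
    l i * (2 * k + 2 * (i : ℕ)).choose (2 * k - 1))
    (fun _ _ => Nat.zero_le _) (Finset.mem_univ i)
  have h3 : 0 < (2 * k + 2 * (i : ℕ) - 1).choose (2 * k - 1) := Nat.choose_pos (by omega)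
  have h4 : 0 < (2 * k + 2 * (i : ℕ)).choose (2 * k - 1) := Nat.choose_pos (by omega)
  have h5 := h1.trans' (Nat.le_mul_of_pos_right (d i) (Nat.add_pos_right _ h3))
  have h6 := h2.trans' (Nat.le_mul_of_pos_right (l i) h4)
  unfold indexCost
  omega

/-- The contribution of the index pair `(d, l)` to the generating function, as a power series. -/
noncomputable def indexTerm (j : ℕ) {b : ℕ} (d l : Fin (b + 1) → ℕ) : PowerSeries ℚ :=
  fractionCoeff (PowerSeries.X ^ (2 * j)) (heightPoly PowerSeries.X (j + 2))⁻¹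
    (heightPoly PowerSeries.X (j + 1)) (d 0) * (binomialWeight d l : PowerSeries ℚ) *
    PowerSeries.X ^ (∑ i, 2 * d i + ∑ i, l i)

/-- The expansion of the generating function by cost, modulo terms of cost larger than `r`. -/
theorem exists_costGF_eq {r j b : ℕ}
    (hb : r < (2 * (j + 1) + 2 * b).choose (2 * j + 1) +
      (2 * (j + 1) + 2 * b + 1).choose (2 * j + 1)) :
    ∃ W : PowerSeries (Polynomial ℚ), costGF (2 * (j + 1)) 0 =
      PowerSeries.map Polynomial.C
        (heightPoly PowerSeries.X (j + 1) * (heightPoly PowerSeries.X (j + 2))⁻¹) *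
          PowerSeries.C (Polynomial.X ^ 0) +
      ∑ d ∈ Fintype.piFinset fun _ : Fin (b + 1) => Finset.range (r + 1),
      ∑ l ∈ Fintype.piFinset fun _ : Fin (b + 1) => Finset.range (r + 1),
        PowerSeries.map Polynomial.C (indexTerm j d l) *
          PowerSeries.C (Polynomial.X ^ indexCost (j + 1) d l) +
      PowerSeries.C (Polynomial.X ^ (r + 1)) * W := by
  let α : ℕ → ℕ := fun i => (2 * i).choose (2 * j + 1)
  let β : ℕ → ℕ := fun i => (2 * i).choose (2 * j + 1) + (2 * i + 1).choose (2 * j + 1)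
  -- All terms with more than `r` marks are killed in the quotient by `q ^ (r + 1)`.
  let I : Ideal (PowerSeries (Polynomial ℚ)) :=
    Ideal.span {PowerSeries.C (Polynomial.X ^ (r + 1))}
  let φ := Ideal.Quotient.mk I
  let ψ : PowerSeries ℚ →+* PowerSeries (Polynomial ℚ) := PowerSeries.map Polynomial.C
  have hψX : ψ PowerSeries.X = PowerSeries.X := PowerSeries.map_X _
  let q : PowerSeries (Polynomial ℚ) := PowerSeries.C Polynomial.X
  have hq {n : ℕ} (hn : r + 1 ≤ n) : φ q ^ n = 0 := by
    rw [← map_pow]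
    refine Ideal.Quotient.eq_zero_iff_mem.2 (Ideal.mem_span_singleton.2 ?_)
    rw [map_pow]
    exact pow_dvd_pow q hn
  have hZ (h : ℕ) : φ (costGF (2 * (j + 1)) h) * (1 - (φ q ^ α h * φ PowerSeries.X +
      φ q ^ β h * φ PowerSeries.X ^ 2 * φ (costGF (2 * (j + 1)) (h + 1)))) = 1 := by
    have h1 := congrArg φ (MotzkinTree.weightGF_eq
      (fun i => (Polynomial.X : Polynomial ℚ) ^ (2 * i).choose (2 * (j + 1) - 1))
      (fun i => Polynomial.X ^ ((2 * i).choose (2 * (j + 1) - 1) +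
        (2 * i + 1).choose (2 * (j + 1) - 1))) h)
    simp only [map_add, map_mul, map_pow, map_one] at h1
    change φ (costGF (2 * (j + 1)) h) = 1 + φ q ^ α h * φ PowerSeries.X *
      φ (costGF (2 * (j + 1)) h) + φ q ^ β h * φ PowerSeries.X ^ 2 *
      φ (costGF (2 * (j + 1)) (h + 1)) * φ (costGF (2 * (j + 1)) h) at h1
    linear_combination h1
  have hα0 (h : ℕ) (hh : h ≤ j) : α h = 0 := Nat.choose_eq_zero_of_lt (by omega)
  have hβ0 (h : ℕ) (hh : h < j) : β h = 0 := by
    simp only [β]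
    rw [Nat.choose_eq_zero_of_lt (by omega), Nat.choose_eq_zero_of_lt (by omega)]
  have hα1 (h : ℕ) (hh : j + 1 ≤ h) : 1 ≤ α h := Nat.choose_pos (by omega)
  have hβ1 (h : ℕ) (hh : j ≤ h) : 1 ≤ β h := Nat.add_pos_right _ (Nat.choose_pos (by omega))
  have hc : heightPoly (φ PowerSeries.X) (j + 2) *
      φ (ψ (heightPoly PowerSeries.X (j + 2))⁻¹) = 1 := by
    have h0 : heightPoly (φ PowerSeries.X) (j + 2) =
        φ (ψ (heightPoly PowerSeries.X (j + 2))) := by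
      rw [map_heightPoly ψ, hψX, map_heightPoly]
    rw [h0, ← map_mul, ← map_mul, PowerSeries.mul_inv_cancel, map_one, map_one]
    rw [constantCoeff_heightPoly_X]
    exact one_ne_zero
  have key := continuedFraction_eq_sum (N := r) (b := b) (j := j) (x := φ PowerSeries.X)
    (A := fun h => φ q ^ α h * φ PowerSeries.X) (B := fun h => φ q ^ β h * φ PowerSeries.X ^ 2)
    (Z := fun h => φ (costGF (2 * (j + 1)) h)) hZ
    (fun h hh => by simp only [hα0 h hh, pow_zero, one_mul])
    (fun h hh => by simp only [hβ0 h hh, pow_zero, one_mul])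
    (fun h l e hle => by
      have h1 : l ≤ α (j + 1 + h) * l := Nat.le_mul_of_pos_left _ (hα1 _ (by omega))
      have h2 : e ≤ β (j + 1 + h) * e := Nat.le_mul_of_pos_left _ (hβ1 _ (by omega))
      have h3 : φ q ^ (α (j + 1 + h) * l + β (j + 1 + h) * e) = 0 := hq (by omega)
      rw [pow_add, pow_mul, pow_mul] at h3
      rw [mul_pow, mul_pow, mul_mul_mul_comm, h3, zero_mul])
    (by
      rw [mul_pow, ← pow_mul, hq (Nat.le_mul_of_pos_left _ (hβ1 j le_rfl)), zero_mul])
    (by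
      -- An up step from height `j + 1 + b` costs more than `r`, so the fraction stops there.
      have h1 : r + 1 ≤ β (j + 1 + b) := by
        simp only [β]
        rw [mul_add]
        omega
      rw [hq h1, zero_mul]) hc
  have hterm (d l : Fin (b + 1) → ℕ) :
      fractionCoeff (φ PowerSeries.X ^ (2 * j)) (φ (ψ (heightPoly PowerSeries.X (j + 2))⁻¹))
        (heightPoly (φ PowerSeries.X) (j + 1)) (d 0) * ((binomialWeight d l : ℕ) : _ ⧸ I) *
        ((∏ i : Fin (b + 1), (φ q ^ β (j + i) * φ PowerSeries.X ^ 2) ^ d i) *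
          ∏ i : Fin (b + 1), (φ q ^ α (j + 1 + i) * φ PowerSeries.X) ^ l i) =
      φ (ψ (indexTerm j d l) * PowerSeries.C (Polynomial.X ^ indexCost (j + 1) d l)) := by
    have e1 : heightPoly (φ PowerSeries.X) (j + 1) =
        φ (ψ (heightPoly PowerSeries.X (j + 1))) := by
      rw [map_heightPoly ψ, hψX, map_heightPoly]
    have e2 : φ PowerSeries.X = φ (ψ PowerSeries.X) := by rw [hψX]
    have e3 : indexCost (j + 1) d l = ∑ i : Fin (b + 1), β (j + i) * d i +
        ∑ i : Fin (b + 1), α (j + 1 + i) * l i := by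
      unfold indexCost
      congr 1 <;> refine Finset.sum_congr rfl fun i _ => ?_
      · rw [mul_comm]
        simp only [β]
        congr 3 <;> omega
      · rw [mul_comm]
        simp only [α]
        congr 2
        omega
    rw [e1, e2, indexTerm, map_mul, map_mul, map_mul, map_mul, map_mul, map_fractionCoeff,
      map_fractionCoeff, map_natCast, map_natCast, map_pow ψ, map_pow φ, map_pow ψ, map_pow φ,
      map_pow PowerSeries.C, map_pow φ, e3, pow_add, pow_add, ← Finset.prod_pow_eq_pow_sum,
      ← Finset.prod_pow_eq_pow_sum, ← Finset.prod_pow_eq_pow_sum, ← Finset.prod_pow_eq_pow_sum]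
    simp only [mul_pow, Finset.prod_mul_distrib, pow_mul]
    ring
  simp only [hterm] at key
  rw [show heightPoly (φ PowerSeries.X) (j + 1) = φ (ψ (heightPoly PowerSeries.X (j + 1))) by
    rw [map_heightPoly ψ, hψX, map_heightPoly], ← map_mul, ← map_mul] at key
  simp only [← map_sum] at key
  rw [← map_add] at key
  obtain ⟨W, hW⟩ := Ideal.mem_span_singleton.1 (Ideal.Quotient.eq.1 key)
  refine ⟨W, ?_⟩
  rw [← hW, pow_zero, map_one, mul_one]
  ring

theorem involutionGF_eq_sum_indexTerm {r j b : ℕ} (hr : 1 ≤ r) (hk : 1 ≤ j + 1)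
    (hb : r < (2 * (j + 1) + 2 * b).choose (2 * j + 1) +
      (2 * (j + 1) + 2 * b + 1).choose (2 * j + 1)) :
    involutionGF (2 * (j + 1)) r =
      ∑ p ∈ (indexSet_finite hk b r).toFinset, indexTerm j p.1 p.2 := by
  obtain ⟨W, hW⟩ := exists_costGF_eq hb
  ext n
  have h := congrArg (fun f => (PowerSeries.coeff n f).coeff r) hW
  rw [coeff_coeff_costGF (by omega), map_add, map_add, Polynomial.coeff_add, Polynomial.coeff_add,
    coeff_coeff_map_C_mul, if_neg (by omega), PowerSeries.coeff_C_mul, Polynomial.coeff_X_pow_mul',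
    if_neg (by omega), zero_add, add_zero, ← Finset.sum_product', map_sum,
    Polynomial.finsetSum_coeff] at h
  simp only [coeff_coeff_map_C_mul] at h
  rw [h, ← Finset.sum_filter, map_sum]
  refine Finset.sum_congr ?_ fun _ _ => rfl
  ext p
  rw [Finset.mem_filter, Finset.mem_product, Fintype.mem_piFinset, Fintype.mem_piFinset,
    Set.Finite.mem_toFinset]
  change _ ↔ r = indexCost (j + 1) p.1 p.2
  refine and_iff_right_of_imp fun hp => ⟨fun i => ?_, fun i => ?_⟩
  · have := (le_indexCost hk p.1 p.2 i).1
    exact Finset.mem_range.2 (by omega)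
  · have := (le_indexCost hk p.1 p.2 i).2
    exact Finset.mem_range.2 (by omega)

/-- A pair of sequences with `d 0 = 0` that is not identically zero has weight zero. -/
theorem binomialWeight_eq_zero {k b : ℕ} {d l : Fin (b + 1) → ℕ} (hd : d 0 = 0)
    (h : indexCost k d l ≠ 0) : binomialWeight d l = 0 := by
  by_contra hw
  rw [binomialWeight, ← ne_eq, Finset.prod_ne_zero_iff] at hw
  -- `C(s - 1, s)` vanishes unless `s = 0`, where truncation makes it `C(0, 0) = 1`.
  have step (i : Fin (b + 1)) (hi : d i = 0) : nextEntry d i = 0 ∧ l i = 0 := by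
    have h1 := left_ne_zero_of_mul (hw i (Finset.mem_univ i))
    by_contra hc
    exact h1 (Nat.choose_eq_zero_of_lt (by omega))
  have hall (n : ℕ) (hn : n < b + 1) : d ⟨n, hn⟩ = 0 := by
    induction n with
    | zero => exact hd
    | succ n ih =>
      have h1 := (step ⟨n, by omega⟩ (ih (by omega))).1
      rwa [nextEntry, dif_pos hn] at h1
  refine h ?_
  unfold indexCost
  rw [Finset.sum_eq_zero fun i _ => by rw [hall i i.2, zero_mul],
    Finset.sum_eq_zero fun i _ => by rw [(step i (hall i i.2)).2, zero_mul],
    add_zero]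

/-! ### Laurent series and Chebyshev polynomials -/

theorem xL_ne_zero : xL ≠ 0 := HahnSeries.single_ne_zero one_ne_zero

theorem ofPowerSeries_X_eq_xL : HahnSeries.ofPowerSeries ℤ ℚ PowerSeries.X = xL :=
  HahnSeries.ofPowerSeries_X

theorem xL_mul_heightPoly (n : ℕ) :
    xL * heightPoly xL n = xL ^ n * chebyshevAt ((n : ℤ) - 1) := by
  have hx := xL_ne_zero
  have h2 : (2 : LaurentSeries ℚ) ≠ 0 := by
    rw [← map_ofNat (algebraMap ℚ (LaurentSeries ℚ)) 2]
    exact (map_ne_zero _).2 two_ne_zero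
  induction n using Nat.twoStepInduction with
  | zero => simp [heightPoly, chebyshevAt]
  | one => simp [heightPoly, chebyshevAt]
  | more n ih1 ih2 =>
    have hU : chebyshevAt (((n + 2 : ℕ) : ℤ) - 1) = 2 * ((1 - xL) / (2 * xL)) *
        chebyshevAt (((n + 1 : ℕ) : ℤ) - 1) - chebyshevAt ((n : ℤ) - 1) := by
      have h := Polynomial.Chebyshev.U_add_two (LaurentSeries ℚ) ((n : ℤ) - 1)
      have e1 : ((n + 2 : ℕ) : ℤ) - 1 = (n : ℤ) - 1 + 2 := by push_cast; ring
      have e2 : ((n + 1 : ℕ) : ℤ) - 1 = (n : ℤ) - 1 + 1 := by push_cast; ring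
      rw [e1, e2]
      simp only [chebyshevAt, h, Polynomial.eval_sub, Polynomial.eval_mul, Polynomial.eval_X,
        Polynomial.eval_ofNat]
    have hdiv : 2 * ((1 - xL) / (2 * xL)) * xL = 1 - xL := by field_simp
    rw [hU, heightPoly]
    linear_combination (1 - xL) * ih2 - xL ^ 2 * ih1 -
      xL ^ (n + 1) * chebyshevAt (((n + 1 : ℕ) : ℤ) - 1) * hdiv

theorem heightPoly_xL_succ (n : ℕ) : heightPoly xL (n + 1) = xL ^ n * chebyshevAt n := by
  have h := xL_mul_heightPoly (n + 1)
  rw [Nat.cast_add, Nat.cast_one, add_sub_cancel_right, pow_succ', mul_assoc] at h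
  exact mul_left_cancel₀ xL_ne_zero h

theorem collect_powers {K : Type*} [Field K] {x v : K} (hx : x ≠ 0) (hv : v ≠ 0) (u w : K)
    (j e s : ℕ) : x ^ (2 * j) * (x ^ j * u) ^ e * ((x ^ (j + 1) * v)⁻¹) ^ (e + 1 + 1) * w * x ^ s =
      w * (u ^ e / v ^ (e + 2)) * (x ^ s / x ^ (e + 2)) := by
  have hy : x ^ j ≠ 0 := pow_ne_zero j hx
  rw [mul_comm 2 j, pow_mul, pow_succ x j]
  generalize x ^ j = y at hy
  simp only [mul_pow, inv_pow, pow_add, pow_one]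
  field_simp

theorem ofPowerSeries_indexTerm {j b : ℕ} {d : Fin (b + 1) → ℕ} (l : Fin (b + 1) → ℕ)
    (hd : d 0 ≠ 0) :
    HahnSeries.ofPowerSeries ℤ ℚ (indexTerm j d l) =
      (binomialWeight d l : LaurentSeries ℚ) *
        (chebyshevAt j ^ ((d 0 : ℤ) - 1) / chebyshevAt (j + 1 : ℕ) ^ ((d 0 : ℤ) + 1)) *
        xL ^ (-1 - (d 0 : ℤ) + ∑ i : Fin (b + 1), (2 * (d i : ℤ) + (l i : ℤ))) := by
  obtain ⟨e, he⟩ := Nat.exists_eq_add_one_of_ne_zero hd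
  have hx := xL_ne_zero
  have hcc :
      PowerSeries.constantCoeff (heightPoly (PowerSeries.X : PowerSeries ℚ) (j + 2)) ≠ 0 := by
    rw [constantCoeff_heightPoly_X]
    exact one_ne_zero
  have hinv := congrArg (HahnSeries.ofPowerSeries ℤ ℚ)
    (PowerSeries.mul_inv_cancel (heightPoly (PowerSeries.X : PowerSeries ℚ) (j + 2)) hcc)
  rw [map_mul, map_one, map_heightPoly, ofPowerSeries_X_eq_xL, heightPoly_xL_succ] at hinv
  have hV : chebyshevAt (j + 1 : ℕ) ≠ 0 := by
    intro h
    rw [h, mul_zero, zero_mul] at hinv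
    exact zero_ne_one hinv
  have e1 : (d 0 : ℤ) - 1 = (e : ℕ) := by rw [he]; push_cast; ring
  have e2 : (d 0 : ℤ) + 1 = (e + 2 : ℕ) := by rw [he]; push_cast; ring
  have e3 : -1 - (d 0 : ℤ) + ∑ i : Fin (b + 1), (2 * (d i : ℤ) + (l i : ℤ)) =
      ((∑ i, 2 * d i + ∑ i, l i : ℕ) : ℤ) - (e + 2 : ℕ) := by
    rw [he, Finset.sum_add_distrib]
    push_cast
    ring
  rw [e1, e2, e3, zpow_sub₀ hx, zpow_natCast, zpow_natCast, zpow_natCast, zpow_natCast, indexTerm,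
    map_mul, map_mul, map_fractionCoeff, map_natCast, map_pow, map_pow, map_heightPoly,
    ofPowerSeries_X_eq_xL, heightPoly_xL_succ, eq_inv_of_mul_eq_one_right hinv, fractionCoeff,
    if_neg hd, he, Nat.add_sub_cancel]
  exact collect_powers hx hV _ _ j e _

theorem mainTheorem3 (r k b : ℕ) (hr : 1 ≤ r) (hk : 1 ≤ k)
    (hb : r < min ((2 * k + 2 * b + 2).choose (2 * k - 1))
      ((2 * k + 2 * b).choose (2 * k - 1) + (2 * k + 2 * b + 1).choose (2 * k - 1))) :
    HahnSeries.ofPowerSeries ℤ ℚ (involutionGF (2 * k) r) =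
      ∑ p ∈ (indexSet_finite hk b r).toFinset,
        (binomialWeight p.1 p.2 : LaurentSeries ℚ) *
          (chebyshevAt ((k : ℤ) - 1) ^ ((p.1 0 : ℤ) - 1) / chebyshevAt (k : ℤ) ^ ((p.1 0 : ℤ) + 1)) *
          xL ^ (-1 - (p.1 0 : ℤ) + ∑ j : Fin (b + 1), (2 * (p.1 j : ℤ) + (p.2 j : ℤ))) := by
  obtain ⟨j, rfl⟩ := Nat.exists_eq_add_of_le' hk
  rw [involutionGF_eq_sum_indexTerm hr hk (hb.trans_le (min_le_right _ _)), map_sum]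
  refine Finset.sum_congr rfl fun p hp => ?_
  by_cases hd : p.1 0 = 0
  · have hcost : r = indexCost (j + 1) p.1 p.2 := 
      (Set.Finite.mem_toFinset (indexSet_finite hk b r)).1 hp
    rw [indexTerm, binomialWeight_eq_zero (k := j + 1) hd (by omega), Nat.cast_zero, Nat.cast_zero,
      mul_zero, zero_mul, map_zero, zero_mul, zero_mul]
  · rw [ofPowerSeries_indexTerm _ hd, Nat.cast_add, Nat.cast_one, add_sub_cancel_right]
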